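/- Let $\mathscr H$ be a complex Hilbert space with inner product $(\cdot\mid\cdot)$, let $\mathbb B(\mathscr H)$ be the algebra of bounded linear operators on $\mathscr H$ with the operator norm, let $T_1,T_2\in\mathbb B(\mathscr H)$ and $\varepsilon\in[0,1)$. For $S,T\in\mathbb B(\mathscr H)$ write $S\parallel^{\varepsilon}T$ if $\inf\{\|S+\mu T\| : \mu\in\mathbb C\}\le\varepsilon\|S\|$. Then the following statements are equivalent: (i) $T_1\parallel^{\varepsilon}T_2$; (ii) $T_1^*\parallel^{\varepsilon}T_2^*$; (iii) $\alpha T_1\parallel^{\varepsilon}\beta T_2$ for all (equivalently, for some) $\alpha,\beta\in\mathbb C\setminus\{0\}$; (iv) $\sup\{|(T_1\xi\mid\eta)| : \xi,\eta\in\mathscr H,\ \|\xi\|=\|\eta\|=1,\ (T_2\xi\mid\eta)=0\}\le\varepsilon\|T_1\|$, where the supremum of the empty set is $0$. Moreover, each of these conditions implies (v) $|(T_1\xi\mid T_2\xi)|^2\ge\|T_1\xi\|^2\|T_2\xi\|^2-\varepsilon^2\|T_1\|^2\|T_2\|^2$ for all $\xi\in\mathscr H$ with $\|\xi\|=1$.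 -/

import Mathlib

/-- `x` is `ε`-parallel to `y` in a complex normed space:
`inf {‖x + μ y‖ : μ ∈ ℂ} ≤ ε ‖x‖`. -/
def ApproxParallel {V : Type*} [NormedAddCommGroup V] [NormedSpace ℂ V]
    (ε : ℝ) (x y : V) : Prop :=
  sInf {r : ℝ | ∃ μ : ℂ, r = ‖x + μ • y‖} ≤ ε * ‖x‖

/-- The set `{|(T₁ξ|η)| : ‖ξ‖ = ‖η‖ = 1, (T₂ξ|η) = 0}`. The inner product `(u|v)`, linear in its
first variable, is `inner ℂ v u`. The set is bounded above by `‖T₁‖`; where it is empty, its real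
supremum is `0`, the supremum of the empty set in `[0, ∞)`. -/
def orthValues {H : Type*} [NormedAddCommGroup H] [InnerProductSpace ℂ H]
    (T₁ T₂ : H →L[ℂ] H) : Set ℝ :=
  {r : ℝ | ∃ ξ η : H, ‖ξ‖ = 1 ∧ ‖η‖ = 1 ∧ inner ℂ η (T₂ ξ) = 0 ∧ r = ‖inner ℂ η (T₁ ξ)‖}

/-- `|(T₁ξ|T₂ξ)|² ≥ ‖T₁ξ‖² ‖T₂ξ‖² - ε² ‖T₁‖² ‖T₂‖²` for all unit vectors `ξ`. -/
def ReverseCauchySchwarz {H : Type*} [NormedAddCommGroup H] [InnerProductSpace ℂ H]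
    (ε : ℝ) (T₁ T₂ : H →L[ℂ] H) : Prop :=
  ∀ ξ : H, ‖ξ‖ = 1 →
    ‖inner ℂ (T₂ ξ) (T₁ ξ)‖ ^ 2 ≥
      ‖T₁ ξ‖ ^ 2 * ‖T₂ ξ‖ ^ 2 - ε ^ 2 * ‖T₁‖ ^ 2 * ‖T₂‖ ^ 2

/-! Everything rests on a distance formula: the distance from `A` to the line `ℂ B` is the supremum
of `|(A x | y)|` over unit `x`, `y` with `B x ⟂ y`. Adding `μ B` to `A` does not change these
values, so they are bounded by the distance. For the converse let `s` bound the values and replace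
`A` by a nearest point `A + μ B`, so that `A` is Birkhoff–James orthogonal to `B`. A
Toeplitz–Hausdorff argument (`zero_mem_maximalNumericalRange`) gives unit vectors `x n` with `‖A (x
n)‖ → ‖A‖` and `(A (x n) | B (x n)) → 0`. Testing the bound on the part of `A x` orthogonal to `B x`
gives the Gram inequality `gram_le_of_orthogonal`. If `s < ‖A‖`, it forces `B (x n) → 0`, and a
small perturbation of `x n` (`norm_le_of_orthogonal_of_tendsto`) still yields `‖A‖ ≤ s`. The Gram
inequality with `s = ε ‖T₁‖` is also the source of (v). -/

open Filter Topology
open scoped Pointwise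

/-! ### Gram determinants and orthogonal pairs -/

section Gram

variable {H : Type*} [NormedAddCommGroup H] [InnerProductSpace ℂ H]

/-- The condition on unit vectors behind `orthValues` extends to all vectors by homogeneity. -/
theorem norm_inner_le_of_orthogonal {A B : H →L[ℂ] H} {s : ℝ}
    (h : ∀ ξ η : H, ‖ξ‖ = 1 → ‖η‖ = 1 → inner ℂ η (B ξ) = 0 → ‖inner ℂ η (A ξ)‖ ≤ s)
    (x y : H) (hxy : inner ℂ y (B x) = 0) : ‖inner ℂ y (A x)‖ ≤ s * ‖x‖ * ‖y‖ := by
  rcases eq_or_ne x 0 with rfl | hx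
  · simp
  rcases eq_or_ne y 0 with rfl | hy
  · simp
  have hx' : 0 < ‖x‖ := norm_pos_iff.2 hx
  have hy' : 0 < ‖y‖ := norm_pos_iff.2 hy
  have key := h (((‖x‖⁻¹ : ℝ) : ℂ) • x) (((‖y‖⁻¹ : ℝ) : ℂ) • y)
    (by rw [norm_smul, Complex.norm_real, norm_inv, norm_norm, inv_mul_cancel₀ hx'.ne'])
    (by rw [norm_smul, Complex.norm_real, norm_inv, norm_norm, inv_mul_cancel₀ hy'.ne'])
    (by rw [map_smul, inner_smul_left, inner_smul_right, hxy]; simp)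
  rw [map_smul, inner_smul_left, inner_smul_right, norm_mul, norm_mul, Complex.conj_ofReal,
    Complex.norm_real, Complex.norm_real, norm_inv, norm_inv, norm_norm, norm_norm] at key
  have : ‖inner ℂ y (A x)‖ = (‖y‖⁻¹ * (‖x‖⁻¹ * ‖inner ℂ y (A x)‖)) * (‖x‖ * ‖y‖) := by
    field_simp
  rw [this, mul_assoc s]
  gcongr

/-- The Gram determinant of `A x` and `B x` is controlled by the orthogonality condition. -/
theorem gram_le_of_orthogonal {A B : H →L[ℂ] H} {s : ℝ}
    (h : ∀ x y : H, inner ℂ y (B x) = 0 → ‖inner ℂ y (A x)‖ ≤ s * ‖x‖ * ‖y‖) (x : H) :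
    ‖A x‖ ^ 2 * ‖B x‖ ^ 2 - ‖inner ℂ (B x) (A x)‖ ^ 2 ≤ s ^ 2 * ‖x‖ ^ 2 * ‖B x‖ ^ 2 := by
  set a := A x with ha
  set b := B x with hb
  set G : ℝ := ‖a‖ ^ 2 * ‖b‖ ^ 2 - ‖inner ℂ b a‖ ^ 2 with hG
  -- The component of `a` orthogonal to `b`, scaled by `‖b‖ ^ 2` so that `b = 0` needs no separate
  -- case.
  set y : H := ((‖b‖ ^ 2 : ℝ) : ℂ) • a - inner ℂ b a • b with hy
  have hab : (starRingEnd ℂ) (inner ℂ b a) = inner ℂ a b := inner_conj_symm a b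
  have hyb : inner ℂ y b = 0 := by
    rw [hy, inner_sub_left, inner_smul_left, inner_smul_left, hab, inner_self_eq_norm_sq_to_K,
      Complex.conj_ofReal]
    push_cast
    simp only [Complex.coe_algebraMap]
    ring
  have hya : inner ℂ y a = (G : ℂ) := by
    have h1 : (inner ℂ a b : ℂ) * inner ℂ b a = ((‖inner ℂ b a‖ ^ 2 : ℝ) : ℂ) := by
      rw [← hab, Complex.conj_mul']
      push_cast
      rfl
    rw [hy, inner_sub_left, inner_smul_left, inner_smul_left, hab, inner_self_eq_norm_sq_to_K,
      Complex.conj_ofReal, h1, hG]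
    push_cast
    simp only [Complex.coe_algebraMap]
    ring
  have hyy : ‖y‖ ^ 2 = ‖b‖ ^ 2 * G := by
    have h1 : inner ℂ y y = (((‖b‖ ^ 2 * G : ℝ)) : ℂ) := by
      conv_lhs => rw [hy, inner_sub_right, inner_smul_right, inner_smul_right, ← hy, hyb, hya]
      push_cast
      ring
    rw [inner_self_eq_norm_sq_to_K] at h1
    have h2 := congrArg Complex.re h1
    simpa [← Complex.ofReal_pow] using h2
  have hG0 : 0 ≤ G := by
    have := norm_inner_le_norm (𝕜 := ℂ) b a
    have h2 : ‖inner ℂ b a‖ ^ 2 ≤ (‖b‖ * ‖a‖) ^ 2 := by gcongr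
    rw [hG]
    nlinarith
  have key := h x y hyb
  rw [← ha, hya, Complex.norm_real, Real.norm_of_nonneg hG0] at key
  have hsq : G ^ 2 ≤ (s ^ 2 * ‖x‖ ^ 2 * ‖b‖ ^ 2) * G := by
    calc G ^ 2 ≤ (s * ‖x‖ * ‖y‖) ^ 2 := by gcongr
      _ = s ^ 2 * ‖x‖ ^ 2 * ‖y‖ ^ 2 := by ring
      _ = _ := by rw [hyy]; ring
  rcases hG0.eq_or_lt with h0 | h0
  · rw [← h0]; positivity
  · exact le_of_mul_le_mul_right (by rwa [sq] at hsq) h0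

end Gram

/-! ### A Toeplitz–Hausdorff argument on segments -/

section NumericalRange

variable {H : Type*} [NormedAddCommGroup H] [InnerProductSpace ℂ H]

/-- A rotation makes a complex number real. -/
theorem exists_unit_mul_im_eq_zero (w : ℂ) : ∃ c : ℂ, ‖c‖ = 1 ∧ (c * w).im = 0 := by
  rcases eq_or_ne w 0 with rfl | hw
  · exact ⟨1, by simp, by simp⟩
  · refine ⟨(starRingEnd ℂ) w / (‖w‖ : ℂ), ?_, ?_⟩
    · simp [hw]
    · have : (starRingEnd ℂ) w / (‖w‖ : ℂ) * w = ((‖w‖ ^ 2 / ‖w‖ : ℝ) : ℂ) := by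
        rw [div_mul_eq_mul_div, Complex.conj_mul']
        push_cast
        rfl
      rw [this, Complex.ofReal_im]

/-- Among the rotations making a complex number real, one has a nonnegative real part against a
second number. -/
theorem exists_unit_mul_im_eq_zero_re_nonneg (w v : ℂ) :
    ∃ c : ℂ, ‖c‖ = 1 ∧ (c * w).im = 0 ∧ 0 ≤ (c * v).re := by
  obtain ⟨c, hc, hw⟩ := exists_unit_mul_im_eq_zero w
  rcases le_total 0 (c * v).re with h | h
  · exact ⟨c, hc, hw, h⟩
  · refine ⟨-c, by simpa using hc, ?_, ?_⟩
    · rw [neg_mul, Complex.neg_im, hw, neg_zero]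
    · rw [neg_mul, Complex.neg_re]; linarith

/-- The norm square along a segment. -/
theorem norm_sq_segment {E : Type*} [NormedAddCommGroup E] [InnerProductSpace ℂ E] (x y : E)
    (t : ℝ) : ‖(t : ℂ) • x + ((1 - t : ℝ) : ℂ) • y‖ ^ 2 =
      t * ‖x‖ ^ 2 + (1 - t) * ‖y‖ ^ 2 - t * (1 - t) * ‖x - y‖ ^ 2 := by
  rw [@norm_add_sq ℂ, @norm_sub_sq ℂ, norm_smul, norm_smul, inner_smul_left, inner_smul_right,
    Complex.conj_ofReal, Complex.norm_real, Complex.norm_real, mul_pow, mul_pow]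
  simp only [Real.norm_eq_abs, sq_abs, RCLike.re_eq_complex_re, Complex.re_ofReal_mul]
  ring

/-- A quantitative Toeplitz–Hausdorff step: the intermediate values of the quadratic form of `C`
are attained at vectors of a segment that stays away from the origin. -/
theorem exists_segment_inner_eq (C : H →L[ℂ] H) {x₁ x₂ : H} (h₁ : ‖x₁‖ = 1) (h₂ : ‖x₂‖ = 1)
    (hC₁ : inner ℂ x₁ (C x₁) = 0) (hC₂ : inner ℂ x₂ (C x₂) = 1) {l : ℝ}
    (hl : l ∈ Set.Icc (0 : ℝ) 1) :
    ∃ (c : ℂ) (t : ℝ), ‖c‖ = 1 ∧ t ∈ Set.Icc (0 : ℝ) 1 ∧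
      1 / 2 ≤ ‖(t : ℂ) • c • x₁ + ((1 - t : ℝ) : ℂ) • x₂‖ ^ 2 ∧
      inner ℂ ((t : ℂ) • c • x₁ + ((1 - t : ℝ) : ℂ) • x₂)
          (C ((t : ℂ) • c • x₁ + ((1 - t : ℝ) : ℂ) • x₂)) =
        ((l * ‖(t : ℂ) • c • x₁ + ((1 - t : ℝ) : ℂ) • x₂‖ ^ 2 : ℝ) : ℂ) := by
  -- The rotation makes the cross terms of the quadratic form real; the sign condition gives `‖y t‖
  -- ^ 2 ≥ t ^ 2 + (1 - t) ^ 2 ≥ 1 / 2`.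
  obtain ⟨c, hc, him, hre⟩ := exists_unit_mul_im_eq_zero_re_nonneg
    (inner ℂ x₂ (C x₁) - (starRingEnd ℂ) (inner ℂ x₁ (C x₂))) (inner ℂ x₂ x₁)
  set k : ℝ := ((starRingEnd ℂ) c * inner ℂ x₁ (C x₂) + c * inner ℂ x₂ (C x₁)).re with hk
  have hcross : (starRingEnd ℂ) c * inner ℂ x₁ (C x₂) + c * inner ℂ x₂ (C x₁) = (k : ℂ) := by
    apply Complex.ext
    · simp [hk]
    · simp only [Complex.mul_im, Complex.sub_re, Complex.sub_im, Complex.conj_re,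
        Complex.conj_im] at him
      simp only [Complex.add_im, Complex.mul_im, Complex.conj_re, Complex.conj_im,
        Complex.ofReal_im]
      linarith
  have hcc : (starRingEnd ℂ) c * c = 1 := by rw [Complex.conj_mul', hc]; simp
  let y : ℝ → H := fun t => (t : ℂ) • c • x₁ + ((1 - t : ℝ) : ℂ) • x₂
  have hCy : ∀ t : ℝ, inner ℂ (y t) (C (y t)) = (((1 - t) ^ 2 + t * (1 - t) * k : ℝ) : ℂ) := by
    intro t
    simp only [y, map_add, map_smul, inner_add_left, inner_add_right, inner_smul_left,
      inner_smul_right, hC₁, hC₂, Complex.conj_ofReal]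
    push_cast
    rw [← hcross]
    ring
  have hny : ∀ t : ℝ, ‖y t‖ ^ 2 = t ^ 2 + (1 - t) ^ 2 + 2 * (t * (1 - t)) *
      (c * inner ℂ x₂ x₁).re := by
    intro t
    have hx : (inner ℂ (c • x₁) x₂).re = (c * inner ℂ x₂ x₁).re := by
      rw [inner_smul_left, ← inner_conj_symm x₁ x₂, ← map_mul, Complex.conj_re]
    simp only [y]
    rw [norm_sq_segment, @norm_sub_sq ℂ, norm_smul, hc, h₁, h₂, RCLike.re_eq_complex_re, hx]
    ring
  have hcont : Continuous fun t : ℝ => (1 - t) ^ 2 + t * (1 - t) * k - l * ‖y t‖ ^ 2 := by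
    simp only [hny]
    fun_prop
  obtain ⟨t, ht, ht0⟩ : (0 : ℝ) ∈
      (fun t : ℝ => (1 - t) ^ 2 + t * (1 - t) * k - l * ‖y t‖ ^ 2) '' Set.Icc 0 1 := by
    apply intermediate_value_Icc' zero_le_one hcont.continuousOn
    simp only [hny]
    constructor <;> norm_num <;> linarith [hl.1, hl.2]
  refine ⟨c, t, hc, ht, ?_, ?_⟩
  · change 1 / 2 ≤ ‖y t‖ ^ 2
    rw [hny]
    have := mul_nonneg (mul_nonneg ht.1 (sub_nonneg.2 ht.2)) hre
    nlinarith [sq_nonneg (2 * t - 1)]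
  · change inner ℂ (y t) (C (y t)) = ((l * ‖y t‖ ^ 2 : ℝ) : ℂ)
    rw [hCy]
    congr 1
    simp only at ht0
    linarith

end NumericalRange

/-! ### The maximal numerical range of a pair of operators -/

section AlmostNorming

variable {H : Type*} [NormedAddCommGroup H] [InnerProductSpace ℂ H]

theorem ContinuousLinearMap.exists_unit_lt_norm_sq [Nontrivial H] (T : H →L[ℂ] H) {r : ℝ}
    (hr : r < ‖T‖ ^ 2) : ∃ x : H, ‖x‖ = 1 ∧ r < ‖T x‖ ^ 2 := by
  by_contra! hcon
  obtain ⟨x₀, hx₀⟩ := exists_norm_eq H zero_le_one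
  have hr0 : 0 ≤ r := (sq_nonneg _).trans (hcon x₀ hx₀)
  have hT : ‖T‖ ≤ √r := by
    refine T.opNorm_le_of_unit_norm (Real.sqrt_nonneg r) fun x hx => ?_
    exact Real.le_sqrt_of_sq_le (hcon x hx)
  have : ‖T‖ ^ 2 ≤ √r ^ 2 := by gcongr
  rw [Real.sq_sqrt hr0] at this
  linarith

/-- The values of `x ↦ (A x | B x)` at almost norming unit vectors of `A` are convex up to a
factor in the defect. -/
theorem exists_unit_inner_eq_segment [CompleteSpace H] (A B : H →L[ℂ] H) {δ : ℝ} {x₁ x₂ : H}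
    (h₁ : ‖x₁‖ = 1) (h₂ : ‖x₂‖ = 1) (hd₁ : ‖A‖ ^ 2 - ‖A x₁‖ ^ 2 ≤ δ)
    (hd₂ : ‖A‖ ^ 2 - ‖A x₂‖ ^ 2 ≤ δ) {l : ℝ} (hl : l ∈ Set.Icc (0 : ℝ) 1) :
    ∃ x : H, ‖x‖ = 1 ∧ ‖A‖ ^ 2 - ‖A x‖ ^ 2 ≤ 2 * δ ∧
      inner ℂ (B x) (A x) =
        ((1 - l : ℝ) : ℂ) * inner ℂ (B x₁) (A x₁) + (l : ℂ) * inner ℂ (B x₂) (A x₂) := by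
  have hA : ∀ x : H, 0 ≤ ‖A‖ ^ 2 * ‖x‖ ^ 2 - ‖A x‖ ^ 2 := fun x => by
    have : ‖A x‖ ^ 2 ≤ (‖A‖ * ‖x‖) ^ 2 := by gcongr; exact A.le_opNorm x
    rw [mul_pow] at this
    linarith
  have hδ : 0 ≤ δ := by
    have := hA x₁
    rw [h₁] at this
    linarith
  set z₁ : ℂ := inner ℂ (B x₁) (A x₁) with hz₁
  set z₂ : ℂ := inner ℂ (B x₂) (A x₂) with hz₂
  rcases eq_or_ne z₁ z₂ with heq | hne
  · refine ⟨x₁, h₁, by linarith, ?_⟩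
    rw [← hz₁, ← heq]
    push_cast
    ring
  have hne' : z₂ - z₁ ≠ 0 := sub_ne_zero.2 hne.symm
  -- Affine normalisation of `B* A`: the form takes the values `0` at `x₁` and `1` at `x₂`.
  let C : H →L[ℂ] H := (z₂ - z₁)⁻¹ •
    ((ContinuousLinearMap.adjoint B).comp A - z₁ • ContinuousLinearMap.id ℂ H)
  have hC : ∀ x : H, inner ℂ x (C x) =
      (z₂ - z₁)⁻¹ * (inner ℂ (B x) (A x) - z₁ * ((‖x‖ ^ 2 : ℝ) : ℂ)) := by
    intro x
    simp only [C, smul_apply, sub_apply,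
      ContinuousLinearMap.comp_apply, ContinuousLinearMap.id_apply, inner_smul_right,
      inner_sub_right, ContinuousLinearMap.adjoint_inner_right, inner_self_eq_norm_sq_to_K]
    push_cast
    rfl
  obtain ⟨c, t, hc, ht, hhalf, hval⟩ := exists_segment_inner_eq C h₁ h₂
    (by rw [hC, h₁, ← hz₁]; simp) (by rw [hC, h₂, ← hz₂]; simp [hne']) hl
  set y : H := (t : ℂ) • c • x₁ + ((1 - t : ℝ) : ℂ) • x₂ with hy
  have hy0 : 0 < ‖y‖ := by
    rcases (norm_nonneg y).eq_or_lt with h | h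
    · rw [← h] at hhalf; norm_num at hhalf
    · exact h
  have hBA : inner ℂ (B y) (A y) = (((1 - l : ℝ) : ℂ) * z₁ + (l : ℂ) * z₂) *
      ((‖y‖ ^ 2 : ℝ) : ℂ) := by
    rw [hC, inv_mul_eq_iff_eq_mul₀ hne'] at hval
    rw [sub_eq_iff_eq_add.1 hval]
    push_cast
    ring
  -- The defect is a nonnegative quadratic form, hence convex along the segment. Normalising `y`
  -- then costs at most the factor `2`, as `‖y‖ ^ 2 ≥ 1 / 2`.
  have hdef : ‖A‖ ^ 2 * ‖y‖ ^ 2 - ‖A y‖ ^ 2 ≤ δ := by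
    have e1 : A y = (t : ℂ) • A (c • x₁) + ((1 - t : ℝ) : ℂ) • A x₂ := by
      rw [hy, map_add, map_smul A (t : ℂ), map_smul A ((1 - t : ℝ) : ℂ)]
    have e2 : ‖A (c • x₁)‖ = ‖A x₁‖ := by rw [map_smul, norm_smul, hc, one_mul]
    have e3 : ‖c • x₁‖ = 1 := by rw [norm_smul, hc, one_mul, h₁]
    rw [e1, hy, norm_sq_segment, norm_sq_segment, e2, e3, h₂, ← map_sub]
    have h3 := mul_nonneg (mul_nonneg ht.1 (sub_nonneg.2 ht.2)) (hA (c • x₁ - x₂))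
    have h4 := mul_le_mul_of_nonneg_left hd₁ ht.1
    have h5 := mul_le_mul_of_nonneg_left hd₂ (sub_nonneg.2 ht.2)
    linarith
  have hinv : ‖y‖⁻¹ ^ 2 * ‖y‖ ^ 2 = 1 := by field_simp
  refine ⟨((‖y‖⁻¹ : ℝ) : ℂ) • y, ?_, ?_, ?_⟩
  · rw [norm_smul, Complex.norm_real, norm_inv, norm_norm, inv_mul_cancel₀ hy0.ne']
  · rw [map_smul, norm_smul, Complex.norm_real, norm_inv, norm_norm, mul_pow]
    have h6 : ‖y‖⁻¹ ^ 2 ≤ 2 := by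
      rw [inv_pow]
      exact inv_le_of_inv_le₀ (by norm_num) (by linarith)
    calc ‖A‖ ^ 2 - ‖y‖⁻¹ ^ 2 * ‖A y‖ ^ 2
        = ‖y‖⁻¹ ^ 2 * (‖A‖ ^ 2 * ‖y‖ ^ 2 - ‖A y‖ ^ 2) := by
          linear_combination (-‖A‖ ^ 2) * hinv
      _ ≤ 2 * δ := mul_le_mul h6 hdef (hA y) (by norm_num)
  · rw [map_smul, map_smul, inner_smul_left, inner_smul_right, hBA, Complex.conj_ofReal]
    have h7 : ((‖y‖⁻¹ : ℝ) : ℂ) * ((‖y‖⁻¹ : ℝ) : ℂ) * ((‖y‖ ^ 2 : ℝ) : ℂ) = 1 := by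
      rw [← Complex.ofReal_mul, ← Complex.ofReal_mul, ← sq, hinv, Complex.ofReal_one]
    linear_combination (((1 - l : ℝ) : ℂ) * z₁ + (l : ℂ) * z₂) * h7

/-- The limits of `(A x | B x)` along norming sequences of unit vectors of `A`. -/
def maximalNumericalRange (A B : H →L[ℂ] H) : Set ℂ :=
  {z | ∀ δ : ℝ, 0 < δ → ∃ x : H, ‖x‖ = 1 ∧ ‖A‖ ^ 2 - ‖A x‖ ^ 2 ≤ δ ∧
    ‖inner ℂ (B x) (A x) - z‖ ≤ δ}

theorem convex_maximalNumericalRange [CompleteSpace H] (A B : H →L[ℂ] H) :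
    Convex ℝ (maximalNumericalRange A B) := by
  intro z₁ hz₁ z₂ hz₂ a l ha hl hal δ hδ
  obtain ⟨x₁, h₁, hd₁, hv₁⟩ := hz₁ (δ / 2) (by positivity)
  obtain ⟨x₂, h₂, hd₂, hv₂⟩ := hz₂ (δ / 2) (by positivity)
  obtain ⟨x, hx, hd, hv⟩ := exists_unit_inner_eq_segment A B h₁ h₂ hd₁ hd₂
    (l := l) ⟨hl, by linarith⟩
  refine ⟨x, hx, by linarith, ?_⟩
  obtain rfl : a = 1 - l := by linarith
  rw [hv, Complex.real_smul, Complex.real_smul, add_sub_add_comm, ← mul_sub, ← mul_sub]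
  refine (norm_add_le _ _).trans ?_
  rw [norm_mul, norm_mul, Complex.norm_real, Complex.norm_real, Real.norm_of_nonneg ha,
    Real.norm_of_nonneg hl]
  have h4 := mul_le_mul_of_nonneg_left hv₁ ha
  have h5 := mul_le_mul_of_nonneg_left hv₂ hl
  linarith

theorem isClosed_maximalNumericalRange (A B : H →L[ℂ] H) :
    IsClosed (maximalNumericalRange A B) := by
  refine isClosed_of_closure_subset fun z hz δ hδ => ?_
  obtain ⟨w, hw, hzw⟩ := Metric.mem_closure_iff.1 hz (δ / 2) (by positivity)
  obtain ⟨x, hx, hd, hv⟩ := hw (δ / 2) (by positivity)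
  refine ⟨x, hx, by linarith, ?_⟩
  rw [dist_comm, dist_eq_norm] at hzw
  have := norm_sub_le_norm_sub_add_norm_sub (inner ℂ (B x) (A x)) w z
  linarith

/-- If `A` is Birkhoff–James orthogonal to `B`, the maximal numerical range meets every closed
half-plane through the origin. -/
theorem exists_mem_maximalNumericalRange_inner_nonpos [Nontrivial H] {A B : H →L[ℂ] H}
    (hAB : ∀ μ : ℂ, ‖A‖ ≤ ‖A + μ • B‖) (v : ℂ) :
    ∃ w ∈ maximalNumericalRange A B, inner ℝ v w ≤ 0 := by
  have step : ∀ t : ℝ, 0 < t → ∃ x : H, ‖x‖ = 1 ∧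
      ‖A‖ ^ 2 - ‖A x‖ ^ 2 ≤ t * (t + 2 * ‖v‖ * (‖B‖ * ‖A‖) + t * ‖v‖ ^ 2 * ‖B‖ ^ 2) ∧
      inner ℝ v (inner ℂ (B x) (A x)) ≤ t * (1 + ‖v‖ ^ 2 * ‖B‖ ^ 2) := by
    intro t ht
    -- The slack `t ^ 2` is of second order, so it survives division of the expanded square by `t`
    -- as an `O(t)` error.
    obtain ⟨x, hx, hlt⟩ := (A + (-(t : ℂ) * v) • B).exists_unit_lt_norm_sq
      (r := ‖A‖ ^ 2 - t ^ 2) (by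
        have : ‖A‖ ^ 2 ≤ ‖A + (-(t : ℂ) * v) • B‖ ^ 2 := by gcongr; exact hAB _
        have := pow_pos ht 2
        linarith)
    have hAx : ‖A x‖ ≤ ‖A‖ := by simpa [hx] using A.le_opNorm x
    have hBx : ‖B x‖ ≤ ‖B‖ := by simpa [hx] using B.le_opNorm x
    have hAx2 : ‖A x‖ ^ 2 ≤ ‖A‖ ^ 2 := by gcongr
    have hBx2 : ‖B x‖ ^ 2 ≤ ‖B‖ ^ 2 := by gcongr
    set w : ℂ := inner ℂ (B x) (A x) with hw
    have hexp : ‖(A + (-(t : ℂ) * v) • B) x‖ ^ 2 =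
        ‖A x‖ ^ 2 - 2 * t * inner ℝ v w + t ^ 2 * ‖v‖ ^ 2 * ‖B x‖ ^ 2 := by
      have h1 : (inner ℂ (A x) ((-(t : ℂ) * v) • B x)).re = -(t * inner ℝ v w) := by
        rw [inner_smul_right, ← inner_conj_symm (A x) (B x), ← hw, neg_mul, neg_mul,
          Complex.neg_re, mul_assoc, Complex.re_ofReal_mul, Complex.inner]
        simp only [Complex.mul_re, Complex.conj_re, Complex.conj_im]
        ring
      rw [add_apply, smul_apply, @norm_add_sq ℂ,
        RCLike.re_eq_complex_re, h1, norm_smul, norm_mul, norm_neg, Complex.norm_real,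
        Real.norm_of_nonneg ht.le]
      ring
    rw [hexp] at hlt
    have hvw : |inner ℝ v w| ≤ ‖v‖ * (‖B‖ * ‖A‖) := by
      refine (abs_real_inner_le_norm v w).trans ?_
      gcongr
      refine (norm_inner_le_norm _ _).trans ?_
      gcongr
    have hB3 : t ^ 2 * ‖v‖ ^ 2 * ‖B x‖ ^ 2 ≤ t ^ 2 * ‖v‖ ^ 2 * ‖B‖ ^ 2 := by gcongr
    refine ⟨x, hx, ?_, ?_⟩
    · have := mul_le_mul_of_nonneg_left (neg_le_of_abs_le hvw) ht.le
      linarith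
    · have h2 : 2 * (inner ℝ v w) ≤ t * (1 + ‖v‖ ^ 2 * ‖B‖ ^ 2) :=
        le_of_mul_le_mul_left (by linarith) ht
      have h3 : 0 ≤ t * (1 + ‖v‖ ^ 2 * ‖B‖ ^ 2) := by positivity
      linarith
  choose x hx hd hi using fun n : ℕ => step (1 / ((n : ℝ) + 1)) (by positivity)
  have ht0 : Tendsto (fun n : ℕ => 1 / ((n : ℝ) + 1)) atTop (𝓝 0) :=
    tendsto_one_div_add_atTop_nhds_zero_nat
  have hbd : ∀ n, inner ℂ (B (x n)) (A (x n)) ∈ Metric.closedBall (0 : ℂ) (‖B‖ * ‖A‖) := by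
    intro n
    rw [mem_closedBall_zero_iff]
    refine (norm_inner_le_norm _ _).trans ?_
    gcongr
    · simpa [hx n] using B.le_opNorm (x n)
    · simpa [hx n] using A.le_opNorm (x n)
  obtain ⟨w, -, φ, hφ, hlim⟩ := tendsto_subseq_of_bounded Metric.isBounded_closedBall hbd
  have htφ := ht0.comp hφ.tendsto_atTop
  refine ⟨w, fun δ hδ => ?_, ?_⟩
  · have hdlim : Tendsto (fun t : ℝ =>
        t * (t + 2 * ‖v‖ * (‖B‖ * ‖A‖) + t * ‖v‖ ^ 2 * ‖B‖ ^ 2)) (𝓝 0) (𝓝 0) :=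
      Continuous.tendsto' (by fun_prop) _ _ (by simp)
    have h1 := (hdlim.comp htφ).eventually (eventually_le_nhds hδ)
    have h2 := hlim.eventually (Metric.closedBall_mem_nhds w hδ)
    obtain ⟨n, hn1, hn2⟩ := (h1.and h2).exists
    exact ⟨x (φ n), hx _, (hd _).trans hn1, by simpa [dist_eq_norm] using hn2⟩
  · have hrlim : Tendsto (fun t : ℝ => t * (1 + ‖v‖ ^ 2 * ‖B‖ ^ 2)) (𝓝 0) (𝓝 0) :=
      Continuous.tendsto' (by fun_prop) _ _ (by simp)
    have hl : Tendsto (fun n => inner ℝ v (inner ℂ (B (x (φ n))) (A (x (φ n))))) atTop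
        (𝓝 (inner ℝ v w)) := tendsto_const_nhds.inner hlim
    exact le_of_tendsto_of_tendsto' hl (hrlim.comp htφ) fun n => hi (φ n)

/-- Birkhoff–James orthogonality of `A` to `B` puts `0` into the maximal numerical range. -/
theorem zero_mem_maximalNumericalRange [CompleteSpace H] [Nontrivial H] {A B : H →L[ℂ] H}
    (hAB : ∀ μ : ℂ, ‖A‖ ≤ ‖A + μ • B‖) : (0 : ℂ) ∈ maximalNumericalRange A B := by
  obtain ⟨w₀, hw₀, -⟩ := exists_mem_maximalNumericalRange_inner_nonpos hAB 0
  -- The point `v` nearest to `0` satisfies `‖v‖ ^ 2 ≤ ⟨v, w⟩` for all `w` in the set; a `w` in the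
  -- opposite half-plane forces `v = 0`.
  obtain ⟨v, hv, hmin⟩ := exists_norm_eq_iInf_of_complete_convex ⟨w₀, hw₀⟩
    (isClosed_maximalNumericalRange A B).isComplete (convex_maximalNumericalRange A B) 0
  rw [norm_eq_iInf_iff_real_inner_le_zero (convex_maximalNumericalRange A B) hv] at hmin
  obtain ⟨w, hw, hvw⟩ := exists_mem_maximalNumericalRange_inner_nonpos hAB v
  have h1 := hmin w hw
  rw [zero_sub, inner_neg_left, inner_sub_right, real_inner_self_eq_norm_sq] at h1
  have h2 : ‖v‖ ^ 2 = 0 := le_antisymm (by linarith) (sq_nonneg _)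
  have h3 : v = 0 := by simpa using h2
  rwa [h3] at hv

end AlmostNorming

/-! ### The distance from an operator to a line -/

section DistanceFormula

variable {H : Type*} [NormedAddCommGroup H] [InnerProductSpace ℂ H]

/-- An operator whose range is not contained in a line has, for every vector `z`, a vector of
controlled norm whose image is a unit vector orthogonal to `z`. -/
theorem exists_bounded_orthogonal_image (B : H →L[ℂ] H) {u₀ : H} (hu₀ : B u₀ ≠ 0)
    (hrank : ∃ u : H, ∀ k : ℂ, B u ≠ k • B u₀) :
    ∃ L : ℝ, 0 ≤ L ∧ ∀ z : H, ∃ u : H, ‖u‖ ≤ L ∧ ‖B u‖ = 1 ∧ inner ℂ (B u) z = 0 := by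
  obtain ⟨u₁, hu₁⟩ := hrank
  have normalise : ∀ u : H, B u ≠ 0 → ∀ z : H, inner ℂ (B u) z = 0 →
      ‖B (((‖B u‖⁻¹ : ℝ) : ℂ) • u)‖ = 1 ∧
        inner ℂ (B (((‖B u‖⁻¹ : ℝ) : ℂ) • u)) z = 0 := by
    intro u hu z hz
    refine ⟨?_, ?_⟩
    · rw [map_smul, norm_smul, Complex.norm_real, norm_inv, norm_norm,
        inv_mul_cancel₀ (norm_ne_zero_iff.2 hu)]
    · rw [map_smul, inner_smul_left, hz, mul_zero]
  -- Gram–Schmidt in the range of `B`, lifted to preimages.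
  let k : ℂ := inner ℂ (B u₀) (B u₁) / inner ℂ (B u₀) (B u₀)
  let u₂ : H := u₁ - k • u₀
  have hBu₂ : B u₂ = B u₁ - k • B u₀ := by simp only [u₂, map_sub, map_smul]
  have hu₂ : B u₂ ≠ 0 := by
    rw [hBu₂, sub_ne_zero]
    exact hu₁ k
  have horth : inner ℂ (B u₂) (B u₀) = 0 := by
    rw [← inner_conj_symm, hBu₂, inner_sub_right, inner_smul_right,
      div_mul_cancel₀ _ (inner_self_ne_zero.2 hu₀), sub_self, map_zero]
  obtain ⟨hn₂, ho₂⟩ := normalise u₂ hu₂ _ horth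
  let e : H := ((‖B u₂‖⁻¹ : ℝ) : ℂ) • u₂
  let f : H := ((‖B u₀‖⁻¹ : ℝ) : ℂ) • u₀
  have hf : ‖B f‖ = 1 := (normalise u₀ hu₀ 0 (inner_zero_right _)).1
  have hef : inner ℂ (B e) (B f) = 0 := by
    simp only [f, map_smul, inner_smul_right]
    rw [ho₂, mul_zero]
  refine ⟨‖e‖ + ‖f‖, by positivity, fun z => ?_⟩
  by_cases hz : inner ℂ (B e) z = 0
  · exact ⟨e, by linarith [norm_nonneg f], hn₂, hz⟩
  -- These coefficients make `a • B e + b • B f` orthogonal to `z`. Orthonormality gives `‖a‖, ‖b‖ ≤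
  -- ‖B u‖`, so the normalised preimage is bounded independently of `z`.
  let a : ℂ := (starRingEnd ℂ) (inner ℂ (B f) z)
  let b : ℂ := -(starRingEnd ℂ) (inner ℂ (B e) z)
  let u : H := a • e + b • f
  have hBu : B u = a • B e + b • B f := by simp only [u, map_add, map_smul]
  have huz : inner ℂ (B u) z = 0 := by
    rw [hBu, inner_add_left, inner_smul_left, inner_smul_left]
    simp only [a, b, map_neg, Complex.conj_conj]
    ring
  have hnorm : ‖B u‖ ^ 2 = ‖a‖ ^ 2 + ‖b‖ ^ 2 := by
    rw [hBu, @norm_add_sq ℂ, inner_smul_left, inner_smul_right, hef, norm_smul, norm_smul, hf,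
      show ‖B e‖ = 1 from hn₂]
    simp
  have ha : ‖a‖ ≤ ‖B u‖ := by
    refine le_of_sq_le_sq ?_ (norm_nonneg _)
    rw [hnorm]; linarith [sq_nonneg ‖b‖]
  have hb : ‖b‖ ≤ ‖B u‖ := by
    refine le_of_sq_le_sq ?_ (norm_nonneg _)
    rw [hnorm]; linarith [sq_nonneg ‖a‖]
  have hb0 : 0 < ‖b‖ := by
    simp only [b, norm_neg, RCLike.norm_conj]
    exact norm_pos_iff.2 hz
  have hBu0 : 0 < ‖B u‖ := hb0.trans_le hb
  obtain ⟨h1, h2⟩ := normalise u (norm_pos_iff.1 hBu0) z huz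
  refine ⟨_, ?_, h1, h2⟩
  rw [norm_smul, Complex.norm_real, norm_inv, norm_norm, inv_mul_le_iff₀ hBu0, mul_add]
  refine (norm_add_le _ _).trans ?_
  rw [norm_smul, norm_smul b]
  gcongr

/-- If an almost norming sequence of `A` is almost annihilated by `B ≠ 0`, then the orthogonality
condition already bounds the norm of `A`. -/
theorem norm_le_of_orthogonal_of_tendsto {A B : H →L[ℂ] H} (hB : B ≠ 0) {s : ℝ} (hs : 0 ≤ s)
    (h : ∀ x y : H, inner ℂ y (B x) = 0 → ‖inner ℂ y (A x)‖ ≤ s * ‖x‖ * ‖y‖)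
    {x : ℕ → H} (hx : ∀ n, ‖x n‖ = 1) (hA : Tendsto (fun n => ‖A (x n)‖) atTop (𝓝 ‖A‖))
    (hBA : Tendsto (fun n => ‖inner ℂ (B (x n)) (A (x n))‖) atTop (𝓝 0))
    (hBx : Tendsto (fun n => ‖B (x n)‖) atTop (𝓝 0)) : ‖A‖ ≤ s := by
  obtain ⟨u₀, hu₀⟩ : ∃ u, B u ≠ 0 := by
    by_contra! hcon
    exact hB (ContinuousLinearMap.ext hcon)
  have hu₀' : 0 < ‖B u₀‖ := norm_pos_iff.2 hu₀
  by_cases hrank : ∃ u : H, ∀ k : ℂ, B u ≠ k • B u₀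
  · obtain ⟨L, hL, hu⟩ := exists_bounded_orthogonal_image B hu₀ hrank
    choose u huL hBu huA using fun n => hu (A (x n))
    have hAu : ∀ n, ‖A (u n)‖ ≤ ‖A‖ * L := fun n =>
      (A.le_opNorm _).trans (by gcongr; exact huL n)
    -- Moving `x n` by `t • u n` makes `‖B (y n)‖` tend to `t`. Since `B (u n) ⟂ A (x n)`, the inner
    -- product of `B (y n)` and `A (y n)` is only `O(t ^ 2)` in the limit, so dividing the Gram
    -- estimate by `t` leaves an `O(t)` error.
    have key : ∀ t : ℝ, 0 < t → ‖A‖ - t * (‖A‖ * L) - s * (1 + t * L) ≤ t * (‖A‖ * L) := by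
      intro t ht
      let y : ℕ → H := fun n => x n + (t : ℂ) • u n
      have hAy : ∀ n, ‖A (x n)‖ - t * (‖A‖ * L) ≤ ‖A (y n)‖ := by
        intro n
        have h1 : ‖(t : ℂ) • A (u n)‖ ≤ t * (‖A‖ * L) := by
          rw [norm_smul, Complex.norm_real, Real.norm_of_nonneg ht.le]
          gcongr
          exact hAu n
        have h2 := norm_sub_le_norm_add (A (x n)) ((t : ℂ) • A (u n))
        simp only [y, map_add, map_smul]
        linarith
      have hy : ∀ n, ‖y n‖ ≤ 1 + t * L := by
        intro n
        refine (norm_add_le _ _).trans ?_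
        rw [hx, norm_smul, Complex.norm_real, Real.norm_of_nonneg ht.le]
        gcongr
        exact huL n
      have hBy : ∀ n, |‖B (y n)‖ - t| ≤ ‖B (x n)‖ := by
        intro n
        have h1 := abs_norm_sub_norm_le (B (y n)) ((t : ℂ) • B (u n))
        rw [norm_smul, hBu, Complex.norm_real, Real.norm_of_nonneg ht.le, mul_one] at h1
        simpa only [y, map_add, map_smul, add_sub_cancel_right] using h1
      have hByA : ∀ n, ‖inner ℂ (B (y n)) (A (y n))‖ ≤
          ‖inner ℂ (B (x n)) (A (x n))‖ + t * (‖B (x n)‖ * (‖A‖ * L)) + t ^ 2 * (‖A‖ * L) := by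
        intro n
        have e1 : inner ℂ (B (y n)) (A (y n)) = inner ℂ (B (x n)) (A (x n)) +
            (t : ℂ) * inner ℂ (B (x n)) (A (u n)) + (t : ℂ) ^ 2 * inner ℂ (B (u n)) (A (u n)) := by
          simp only [y, map_add, map_smul, inner_add_left, inner_add_right, inner_smul_left,
            inner_smul_right, huA, Complex.conj_ofReal]
          ring
        rw [e1]
        refine norm_add₃_le.trans ?_
        rw [norm_mul, norm_mul, norm_pow, Complex.norm_real, Real.norm_of_nonneg ht.le]
        have h1 : ‖inner ℂ (B (x n)) (A (u n))‖ ≤ ‖B (x n)‖ * (‖A‖ * L) :=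
          (norm_inner_le_norm _ _).trans (by gcongr; exact hAu n)
        have h2 : ‖inner ℂ (B (u n)) (A (u n))‖ ≤ ‖A‖ * L :=
          (norm_inner_le_norm _ _).trans (by rw [hBu, one_mul]; exact hAu n)
        gcongr
      have hmain : ∀ n, (‖A (x n)‖ - t * (‖A‖ * L) - s * (1 + t * L)) * ‖B (y n)‖ ≤
          ‖inner ℂ (B (x n)) (A (x n))‖ + t * (‖B (x n)‖ * (‖A‖ * L)) + t ^ 2 * (‖A‖ * L) := by
        intro n
        refine le_trans ?_ (hByA n)
        have hg : ‖A (y n)‖ * ‖B (y n)‖ ≤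
            s * ‖y n‖ * ‖B (y n)‖ + ‖inner ℂ (B (y n)) (A (y n))‖ := by
          refine le_of_sq_le_sq ?_ (by positivity)
          have h1 := gram_le_of_orthogonal h (y n)
          have h2 : 0 ≤ s * ‖y n‖ * ‖B (y n)‖ * ‖inner ℂ (B (y n)) (A (y n))‖ := by positivity
          linarith
        have h3 : (‖A (x n)‖ - t * (‖A‖ * L) - s * (1 + t * L)) * ‖B (y n)‖ ≤
            (‖A (y n)‖ - s * ‖y n‖) * ‖B (y n)‖ := by
          gcongr
          · exact hAy n
          · exact hy n
        linarith
      have hBylim : Tendsto (fun n => ‖B (y n)‖) atTop (𝓝 t) := by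
        rw [tendsto_iff_dist_tendsto_zero]
        exact squeeze_zero (fun _ => dist_nonneg) (fun n => hBy n) hBx
      have hlim := le_of_tendsto_of_tendsto'
        (((hA.sub_const (t * (‖A‖ * L))).sub_const (s * (1 + t * L))).mul hBylim)
        ((hBA.add ((hBx.mul_const (‖A‖ * L)).const_mul t)).add_const (t ^ 2 * (‖A‖ * L))) hmain
      refine le_of_mul_le_mul_right ?_ ht
      linarith
    have hlim : Tendsto (fun t : ℝ => s + t * (2 * (‖A‖ * L) + s * L)) (𝓝[>] 0) (𝓝 s) :=
      (Continuous.tendsto' (by fun_prop) _ _ (by simp)).mono_left nhdsWithin_le_nhds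
    refine ge_of_tendsto hlim ?_
    filter_upwards [self_mem_nhdsWithin] with t ht
    linarith [key t ht]
  -- When `B` has rank one, subtracting a small multiple of `u₀` moves `x n` into `ker B`, where
  -- every `y` is admissible and hence `‖A p‖ ≤ s * ‖p‖`.
  · push Not at hrank
    choose k hk using fun n => hrank (x n)
    have hklim : Tendsto (fun n => ‖k n‖) atTop (𝓝 0) := by
      have h1 := hBx.div_const ‖B u₀‖
      rw [zero_div] at h1
      refine h1.congr fun n => ?_
      rw [hk, norm_smul, mul_div_cancel_right₀ _ hu₀'.ne']
    have hmain : ∀ n, ‖A (x n)‖ ≤ s * (1 + ‖k n‖ * ‖u₀‖) + ‖k n‖ * ‖A u₀‖ := by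
      intro n
      set p : H := x n - k n • u₀ with hp
      have hBp : B p = 0 := by rw [hp, map_sub, map_smul, hk, sub_self]
      have h1 := h p (A p) (by rw [hBp, inner_zero_right])
      rw [inner_self_eq_norm_sq_to_K, norm_pow, RCLike.norm_ofReal, abs_norm, sq] at h1
      have h2 : ‖A p‖ ≤ s * ‖p‖ := by
        rcases (norm_nonneg (A p)).eq_or_lt with h0 | h0
        · rw [← h0]; positivity
        · exact le_of_mul_le_mul_right h1 h0
      have h3 : ‖p‖ ≤ 1 + ‖k n‖ * ‖u₀‖ := by
        refine (norm_sub_le _ _).trans ?_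
        rw [hx, norm_smul]
      have h4 : ‖A (x n)‖ ≤ ‖A p‖ + ‖k n‖ * ‖A u₀‖ := by
        have h5 : A (x n) = A p + k n • A u₀ := by rw [hp, map_sub, map_smul, sub_add_cancel]
        rw [h5, ← norm_smul]
        exact norm_add_le _ _
      have h6 := mul_le_mul_of_nonneg_left h3 hs
      linarith
    have hlim := le_of_tendsto_of_tendsto' hA
      ((((hklim.mul_const ‖u₀‖).const_add 1).const_mul s).add (hklim.mul_const ‖A u₀‖)) hmain
    simpa using hlim

variable [CompleteSpace H]

/-- For `A` Birkhoff–James orthogonal to `B`, the norm of `A` is computed on pairs of vectors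
orthogonal with respect to `B`. -/
theorem norm_le_of_birkhoffJames_of_orthogonal {A B : H →L[ℂ] H} (hB : B ≠ 0) {s : ℝ}
    (hs : 0 ≤ s) (h : ∀ x y : H, inner ℂ y (B x) = 0 → ‖inner ℂ y (A x)‖ ≤ s * ‖x‖ * ‖y‖)
    (hAB : ∀ μ : ℂ, ‖A‖ ≤ ‖A + μ • B‖) : ‖A‖ ≤ s := by
  by_contra! hlt
  have : Nontrivial H := by
    by_contra hH
    rw [not_nontrivial_iff_subsingleton] at hH
    exact hB (ContinuousLinearMap.ext fun x => Subsingleton.elim _ _)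
  have hgap : 0 < ‖A‖ ^ 2 - s ^ 2 := by
    have : s ^ 2 < ‖A‖ ^ 2 := by gcongr
    linarith
  choose x hx hd hv using fun n : ℕ =>
    zero_mem_maximalNumericalRange hAB (1 / ((n : ℝ) + 1)) (by positivity)
  have ht0 : Tendsto (fun n : ℕ => 1 / ((n : ℝ) + 1)) atTop (𝓝 0) :=
    tendsto_one_div_add_atTop_nhds_zero_nat
  simp only [sub_zero] at hv
  have hAx : ∀ n, ‖A (x n)‖ ^ 2 ≤ ‖A‖ ^ 2 := fun n => by
    gcongr
    simpa [hx n] using A.le_opNorm (x n)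
  have hA2 : Tendsto (fun n => ‖A (x n)‖ ^ 2) atTop (𝓝 (‖A‖ ^ 2)) := by
    have h1 := ht0.const_sub (‖A‖ ^ 2)
    rw [sub_zero] at h1
    exact tendsto_of_tendsto_of_tendsto_of_le_of_le h1 tendsto_const_nhds
      (fun n => by linarith [hd n]) hAx
  have hA : Tendsto (fun n => ‖A (x n)‖) atTop (𝓝 ‖A‖) := by
    simpa using hA2.sqrt
  have hBA : Tendsto (fun n => ‖inner ℂ (B (x n)) (A (x n))‖) atTop (𝓝 0) :=
    squeeze_zero (fun _ => norm_nonneg _) hv ht0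
  have hB2 : Tendsto (fun n => ‖B (x n)‖ ^ 2) atTop (𝓝 0) := by
    -- The Gram inequality at `x n`, with `‖A (x n)‖ ^ 2` replaced by `‖A‖ ^ 2` minus its defect;
    -- the assumed gap `s < ‖A‖` permits the division.
    have hbound : ∀ n, ‖B (x n)‖ ^ 2 ≤ (‖inner ℂ (B (x n)) (A (x n))‖ ^ 2 +
        (‖A‖ ^ 2 - ‖A (x n)‖ ^ 2) * ‖B‖ ^ 2) / (‖A‖ ^ 2 - s ^ 2) := by
      intro n
      rw [le_div_iff₀ hgap]
      have h1 := gram_le_of_orthogonal h (x n)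
      rw [hx] at h1
      have h2 : ‖B (x n)‖ ^ 2 ≤ ‖B‖ ^ 2 := by
        gcongr
        simpa [hx n] using B.le_opNorm (x n)
      have h3 := mul_le_mul_of_nonneg_left h2 (sub_nonneg.2 (hAx n))
      linarith
    refine squeeze_zero (fun _ => sq_nonneg _) hbound ?_
    have h4 := ((hBA.pow 2).add ((hA2.const_sub (‖A‖ ^ 2)).mul_const (‖B‖ ^ 2))).div_const
      (‖A‖ ^ 2 - s ^ 2)
    simpa using h4
  have hBx : Tendsto (fun n => ‖B (x n)‖) atTop (𝓝 0) := by
    simpa using hB2.sqrt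
  exact hlt.not_ge (norm_le_of_orthogonal_of_tendsto hB hs h hx hA hBA hBx)

/-- The distance of `A` to the line spanned by `B` is attained and bounded by the orthogonality
condition. -/
theorem exists_norm_add_smul_le_of_orthogonal {A B : H →L[ℂ] H} {s : ℝ} (hs : 0 ≤ s)
    (h : ∀ x y : H, inner ℂ y (B x) = 0 → ‖inner ℂ y (A x)‖ ≤ s * ‖x‖ * ‖y‖) :
    ∃ μ : ℂ, ‖A + μ • B‖ ≤ s := by
  rcases eq_or_ne B 0 with rfl | hB
  · refine ⟨0, ?_⟩
    rw [smul_zero, add_zero]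
    refine A.opNorm_le_bound hs fun x => ?_
    have h1 := h x (A x) (by simp)
    rw [inner_self_eq_norm_sq_to_K, norm_pow, RCLike.norm_ofReal, abs_norm, sq] at h1
    rcases (norm_nonneg (A x)).eq_or_lt with h0 | h0
    · rw [← h0]; positivity
    · exact le_of_mul_le_mul_right h1 h0
  have hB' : 0 < ‖B‖ := norm_pos_iff.2 hB
  -- A minimiser exists by coercivity, since `B ≠ 0` and `ℂ` is proper.
  obtain ⟨μ, hμ⟩ : ∃ μ : ℂ, ∀ ν : ℂ, ‖A + μ • B‖ ≤ ‖A + ν • B‖ := by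
    refine Continuous.exists_forall_le (by fun_prop) ?_
    have h1 : Tendsto (fun ν : ℂ => ‖ν‖ * ‖B‖ - ‖A‖) (cocompact ℂ) atTop :=
      tendsto_atTop_add_const_right _ _ (tendsto_norm_cocompact_atTop.atTop_mul_const hB')
    refine tendsto_atTop_mono (fun ν => ?_) h1
    rw [← norm_smul, add_comm]
    exact norm_sub_le_norm_add _ _
  refine ⟨μ, norm_le_of_birkhoffJames_of_orthogonal hB hs (fun x y hxy => ?_) fun ν => ?_⟩
  · have h1 := h x y hxy
    rwa [add_apply, smul_apply, inner_add_right, inner_smul_right, hxy, mul_zero, add_zero]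
  · rw [add_assoc, ← add_smul]
    exact hμ _

end DistanceFormula

/-! ### Approximate parallelism and the equivalences -/

section ApproxParallel

theorem approxParallel_of_le {V : Type*} [NormedAddCommGroup V] [NormedSpace ℂ V] {ε : ℝ}
    {x y : V} {μ : ℂ} (h : ‖x + μ • y‖ ≤ ε * ‖x‖) : ApproxParallel ε x y :=
  have hbdd : BddBelow {r : ℝ | ∃ ν : ℂ, r = ‖x + ν • y‖} :=
    ⟨0, by rintro r ⟨ν, rfl⟩; exact norm_nonneg _⟩
  (csInf_le hbdd ⟨μ, rfl⟩).trans h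

theorem approxParallel_smul_smul_iff {V : Type*} [NormedAddCommGroup V] [NormedSpace ℂ V]
    (ε : ℝ) (x y : V) {α β : ℂ} (hα : α ≠ 0) (hβ : β ≠ 0) :
    ApproxParallel ε (α • x) (β • y) ↔ ApproxParallel ε x y := by
  have hset : {r : ℝ | ∃ μ : ℂ, r = ‖α • x + μ • β • y‖} =
      ‖α‖ • {r : ℝ | ∃ μ : ℂ, r = ‖x + μ • y‖} := by
    ext r
    rw [Set.mem_smul_set]
    constructor
    · rintro ⟨μ, rfl⟩
      refine ⟨_, ⟨α⁻¹ * μ * β, rfl⟩, ?_⟩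
      rw [smul_eq_mul, ← norm_smul, smul_add, smul_smul, smul_smul]
      congr 3
      field_simp
    · rintro ⟨_, ⟨μ, rfl⟩, rfl⟩
      refine ⟨α * μ * β⁻¹, ?_⟩
      rw [smul_eq_mul, ← norm_smul, smul_add, smul_smul, smul_smul]
      congr 3
      field_simp
  unfold ApproxParallel
  rw [hset, Real.sInf_smul_of_nonneg (norm_nonneg α), smul_eq_mul, norm_smul, mul_left_comm]
  exact mul_le_mul_iff_right₀ (norm_pos_iff.2 hα)

variable {H : Type*} [NormedAddCommGroup H] [InnerProductSpace ℂ H]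

theorem orthValues_le_iff {T₁ T₂ : H →L[ℂ] H} {s : ℝ} (hs : 0 ≤ s) :
    sSup (orthValues T₁ T₂) ≤ s ↔
      ∀ ξ η : H, ‖ξ‖ = 1 → ‖η‖ = 1 → inner ℂ η (T₂ ξ) = 0 → ‖inner ℂ η (T₁ ξ)‖ ≤ s := by
  constructor
  · intro h ξ η hξ hη hξη
    have hbdd : BddAbove (orthValues T₁ T₂) := by
      refine ⟨‖T₁‖, ?_⟩
      rintro r ⟨x, y, hx, hy, -, rfl⟩
      refine (norm_inner_le_norm _ _).trans ?_
      rw [hy, one_mul]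
      simpa [hx] using T₁.le_opNorm x
    exact (le_csSup hbdd ⟨ξ, η, hξ, hη, hξη, rfl⟩).trans h
  · intro h
    -- Nonnegativity of `s` covers the empty set, whose real supremum is `0`.
    refine Real.sSup_le ?_ hs
    rintro r ⟨ξ, η, hξ, hη, hξη, rfl⟩
    exact h ξ η hξ hη hξη

theorem ApproxParallel.norm_inner_le {T₁ T₂ : H →L[ℂ] H} {ε : ℝ} (h : ApproxParallel ε T₁ T₂)
    {ξ η : H} (hξ : ‖ξ‖ = 1) (hη : ‖η‖ = 1) (hξη : inner ℂ η (T₂ ξ) = 0) :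
    ‖inner ℂ η (T₁ ξ)‖ ≤ ε * ‖T₁‖ := by
  have hne : {r : ℝ | ∃ μ : ℂ, r = ‖T₁ + μ • T₂‖}.Nonempty := ⟨_, 0, rfl⟩
  refine le_trans (le_csInf hne ?_) h
  rintro r ⟨μ, rfl⟩
  have h1 : inner ℂ η (T₁ ξ) = inner ℂ η ((T₁ + μ • T₂) ξ) := by
    rw [add_apply, smul_apply, inner_add_right, inner_smul_right, hξη, mul_zero, add_zero]
  rw [h1]
  refine (norm_inner_le_norm _ _).trans ?_
  rw [hη, one_mul]
  simpa [hξ] using (T₁ + μ • T₂).le_opNorm ξ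

theorem reverseCauchySchwarz_of_orthValues_le {T₁ T₂ : H →L[ℂ] H} {ε : ℝ} (hε : 0 ≤ ε)
    (h : sSup (orthValues T₁ T₂) ≤ ε * ‖T₁‖) : ReverseCauchySchwarz ε T₁ T₂ := by
  intro ξ hξ
  have h1 := gram_le_of_orthogonal
    (norm_inner_le_of_orthogonal ((orthValues_le_iff (by positivity)).1 h)) ξ
  rw [hξ] at h1
  have h2 : ‖T₂ ξ‖ ^ 2 ≤ ‖T₂‖ ^ 2 := by
    gcongr
    simpa [hξ] using T₂.le_opNorm ξ
  have h3 : (ε * ‖T₁‖) ^ 2 * ‖T₂ ξ‖ ^ 2 ≤ (ε * ‖T₁‖) ^ 2 * ‖T₂‖ ^ 2 := by gcongr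
  linarith

variable [CompleteSpace H]

theorem approxParallel_iff_orthValues_le {T₁ T₂ : H →L[ℂ] H} {ε : ℝ} (hε : 0 ≤ ε) :
    ApproxParallel ε T₁ T₂ ↔ sSup (orthValues T₁ T₂) ≤ ε * ‖T₁‖ := by
  have hs : 0 ≤ ε * ‖T₁‖ := by positivity
  rw [orthValues_le_iff hs]
  refine ⟨fun h ξ η hξ hη hξη => h.norm_inner_le hξ hη hξη, fun h => ?_⟩
  obtain ⟨μ, hμ⟩ := exists_norm_add_smul_le_of_orthogonal hs (norm_inner_le_of_orthogonal h)
  exact approxParallel_of_le hμ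

/-- The adjoint is a conjugate-linear isometry, so `μ ↦ conj μ` matches the two sets of norms. -/
theorem approxParallel_adjoint_iff (T₁ T₂ : H →L[ℂ] H) (ε : ℝ) :
    ApproxParallel ε (ContinuousLinearMap.adjoint T₁) (ContinuousLinearMap.adjoint T₂) ↔
      ApproxParallel ε T₁ T₂ := by
  have hnorm : ∀ μ : ℂ, ‖ContinuousLinearMap.adjoint T₁ + μ • ContinuousLinearMap.adjoint T₂‖ =
      ‖T₁ + (starRingEnd ℂ) μ • T₂‖ := by
    intro μ
    rw [← LinearIsometryEquiv.norm_map ContinuousLinearMap.adjoint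
      (T₁ + (starRingEnd ℂ) μ • T₂), map_add, map_smulₛₗ, Complex.conj_conj]
  have hset : {r : ℝ | ∃ μ : ℂ, r =
      ‖ContinuousLinearMap.adjoint T₁ + μ • ContinuousLinearMap.adjoint T₂‖} =
      {r : ℝ | ∃ μ : ℂ, r = ‖T₁ + μ • T₂‖} := by
    ext r
    simp only [hnorm, Set.mem_ofPred_eq]
    exact ⟨fun ⟨μ, h⟩ => ⟨_, h⟩, fun ⟨μ, h⟩ => ⟨(starRingEnd ℂ) μ, by simpa using h⟩⟩
  unfold ApproxParallel
  rw [hset, LinearIsometryEquiv.norm_map]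

end ApproxParallel

theorem mainTheorem2 {H : Type*} [NormedAddCommGroup H] [InnerProductSpace ℂ H] [CompleteSpace H]
    (T₁ T₂ : H →L[ℂ] H) (ε : ℝ) (hε : ε ∈ Set.Ico (0 : ℝ) 1) :
    List.TFAE [
      ApproxParallel ε T₁ T₂,
      ApproxParallel ε (ContinuousLinearMap.adjoint T₁) (ContinuousLinearMap.adjoint T₂),
      ∀ α β : ℂ, α ≠ 0 → β ≠ 0 → ApproxParallel ε (α • T₁) (β • T₂),
      ∃ α β : ℂ, α ≠ 0 ∧ β ≠ 0 ∧ ApproxParallel ε (α • T₁) (β • T₂),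
      sSup (orthValues T₁ T₂) ≤ ε * ‖T₁‖] ∧
    (ApproxParallel ε T₁ T₂ → ReverseCauchySchwarz ε T₁ T₂) ∧
    (ApproxParallel ε (ContinuousLinearMap.adjoint T₁) (ContinuousLinearMap.adjoint T₂) →
      ReverseCauchySchwarz ε T₁ T₂) ∧
    (∀ α β : ℂ, α ≠ 0 → β ≠ 0 → ApproxParallel ε (α • T₁) (β • T₂) →
      ReverseCauchySchwarz ε T₁ T₂) ∧
    (sSup (orthValues T₁ T₂) ≤ ε * ‖T₁‖ → ReverseCauchySchwarz ε T₁ T₂) := by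
  have hε₀ : 0 ≤ ε := hε.1
  have h_orth := approxParallel_iff_orthValues_le (T₁ := T₁) (T₂ := T₂) hε₀
  have h_adj := approxParallel_adjoint_iff T₁ T₂ ε
  have h_rev : ApproxParallel ε T₁ T₂ → ReverseCauchySchwarz ε T₁ T₂ := fun h =>
    reverseCauchySchwarz_of_orthValues_le hε₀ (h_orth.1 h)
  refine ⟨?_, h_rev, fun h => h_rev (h_adj.1 h), fun α β hα hβ h =>
    h_rev ((approxParallel_smul_smul_iff ε T₁ T₂ hα hβ).1 h),
    reverseCauchySchwarz_of_orthValues_le hε₀⟩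
  tfae_have 1 ↔ 2 := h_adj.symm
  tfae_have 1 ↔ 5 := h_orth
  tfae_have 1 → 3 := fun h α β hα hβ => (approxParallel_smul_smul_iff ε T₁ T₂ hα hβ).2 h
  tfae_have 3 → 4 := fun h => ⟨1, 1, one_ne_zero, one_ne_zero, h 1 1 one_ne_zero one_ne_zero⟩
  tfae_have 4 → 1 := fun ⟨_, _, hα, hβ, h⟩ => (approxParallel_smul_smul_iff ε T₁ T₂ hα hβ).1 h
  tfae_finish
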